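/- Let $d,n\in\mathbb{N}$, let $\bm{x}\in\mathbb{R}^d$, and let $f:\mathbb{R}^d\to\mathbb{R}$ be a locally Lipschitz function of the form $f=h\circ G$ with $h:\mathbb{R}^n\to\mathbb{R}$ and $G:\mathbb{R}^d\to\mathbb{R}^n$. Suppose that $h$ is differentiable on a neighborhood of $G(\bm{x})$ with gradient $\nabla h$ Lipschitz on a neighborhood of $G(\bm{x})$, that $G$ is Lipschitz on a neighborhood of $\bm{x}$, and that $h$ and $G$ are directionally differentiable, i.e. the one-sided limits $\lim_{t\downarrow 0}\frac{h(\bm{z}+t\bm{w})-h(\bm{z})}{t}$ and $\lim_{t\downarrow 0}\frac{G(\bm{y}+t\bm{v})-G(\bm{y})}{t}$ exist (and are finite) at all points $\bm{z}\in\mathbb{R}^n$, $\bm{y}\in\mathbb{R}^d$ and in all directions $\bm{w}\in\mathbb{R}^n$, $\bm{v}\in\mathbb{R}^d$. For a function $\varphi:\mathbb{R}^d\to\mathbb{R}$ that is locally Lipschitz and directionally differentiable near $\bm{x}$, with directional derivative $\varphi'(\bm{y};\bm{v})=\lim_{t\downarrow0}\frac{\varphi(\bm{y}+t\bm{v})-\varphi(\bm{y})}{t}$,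 define - the Clarke subdifferential $\partial_C\varphi(\bm{x})$ as the convex hull of the set of all $\bm{s}\in\mathbb{R}^d$ for which there is a sequence $\bm{x}_k\to\bm{x}$ such that $\varphi$ is differentiable at each $\bm{x}_k$ and $\nabla\varphi(\bm{x}_k)\to\bm{s}$; - the Fréchet subdifferential $\widehat\partial\varphi(\bm{y})=\{\bm{s}\in\mathbb{R}^d:\langle\bm{s},\bm{v}\rangle\le\varphi'(\bm{y};\bm{v})\text{ for all }\bm{v}\in\mathbb{R}^d\}$ for $\bm{y}$ near $\bm{x}$; - the limiting subdifferential $\partial\varphi(\bm{x})$ as the set of all limits of sequences $\bm{s}_k\in\widehat\partial\varphi(\bm{x}_k)$ with $\bm{x}_k\to\bm{x}$. Let $\bar f:\mathbb{R}^d\to\mathbb{R}$, $\bar f(\bm{y})=\big\langle\nabla h(G(\bm{x})),G(\bm{y})\big\rangle$. Then $$\partial_C f(\bm{x})=\partial_C\bar f(\bm{x}),\qquad \partial f(\bm{x})=\partial\bar f(\bm{x}),\qquad \widehat\partial f(\bm{x})=\widehat\partial\bar f(\bm{x}).$$ -/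

import Mathlib

open Filter Topology

namespace PartialLinearization

/-- `l` is the (one-sided) directional derivative `f'(x; v) = lim_{t ↓ 0} (f (x + t v) - f x) / t`
of `f` at `x` in the direction `v`. -/
def HasDirDerivAt {d : ℕ} {F : Type*} [NormedAddCommGroup F] [NormedSpace ℝ F]
    (f : EuclideanSpace ℝ (Fin d) → F) (x v : EuclideanSpace ℝ (Fin d)) (l : F) : Prop :=
  Tendsto (fun t : ℝ => t⁻¹ • (f (x + t • v) - f x)) (𝓝[>] (0 : ℝ)) (𝓝 l)

/-- `f` is directionally differentiable: `f'(x; v)` exists at every point in every direction. -/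
def DirDifferentiable {d : ℕ} {F : Type*} [NormedAddCommGroup F] [NormedSpace ℝ F]
    (f : EuclideanSpace ℝ (Fin d) → F) : Prop :=
  ∀ x v, ∃ l, HasDirDerivAt f x v l

/-- The map `f` is Lipschitz on some neighbourhood of `x`. -/
def LipschitzNear {d : ℕ} {F : Type*} [NormedAddCommGroup F]
    (f : EuclideanSpace ℝ (Fin d) → F) (x : EuclideanSpace ℝ (Fin d)) : Prop :=
  ∃ U ∈ 𝓝 x, ∃ K : NNReal, LipschitzOnWith K f U

/-- The gradient of `f` exists on a neighbourhood of `x` and is Lipschitz near `x`. -/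
def LipschitzGradientNear {d : ℕ}
    (f : EuclideanSpace ℝ (Fin d) → ℝ) (x : EuclideanSpace ℝ (Fin d)) : Prop :=
  (∀ᶠ y in 𝓝 x, DifferentiableAt ℝ f y) ∧ LipschitzNear (gradient f) x

/-- The Clarke subdifferential: the convex hull of all limits of gradients `∇f(xₖ)`, where
`xₖ → x` and `f` is differentiable at each `xₖ`. -/
def clarkeSubdiff {d : ℕ} (f : EuclideanSpace ℝ (Fin d) → ℝ) (x : EuclideanSpace ℝ (Fin d)) :
    Set (EuclideanSpace ℝ (Fin d)) :=
  convexHull ℝ {s | ∃ u : ℕ → EuclideanSpace ℝ (Fin d), Tendsto u atTop (𝓝 x) ∧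
    (∀ k, DifferentiableAt ℝ f (u k)) ∧ Tendsto (fun k => gradient f (u k)) atTop (𝓝 s)}

/-- The Fréchet subdifferential `{s | ⟨s, v⟩ ≤ f'(x; v) for all v}` of a function that is
locally Lipschitz near `x` and directionally differentiable at `x`. -/
def frechetSubdiff {d : ℕ} (f : EuclideanSpace ℝ (Fin d) → ℝ) (x : EuclideanSpace ℝ (Fin d)) :
    Set (EuclideanSpace ℝ (Fin d)) :=
  {s | ∀ v, ∃ l : ℝ, HasDirDerivAt f x v l ∧ inner ℝ s v ≤ l}

/-- The Kuratowski outer limit `limsup_{y → x} S(y)` of a set-valued map: all limits of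
sequences `sₖ ∈ S(uₖ)` with `uₖ → x`. -/
def outerLimit {d : ℕ}
    (S : EuclideanSpace ℝ (Fin d) → Set (EuclideanSpace ℝ (Fin d)))
    (x : EuclideanSpace ℝ (Fin d)) : Set (EuclideanSpace ℝ (Fin d)) :=
  {s | ∃ u w : ℕ → EuclideanSpace ℝ (Fin d), Tendsto u atTop (𝓝 x) ∧
    (∀ k, w k ∈ S (u k)) ∧ Tendsto w atTop (𝓝 s)}

/-- The limiting (Mordukhovich) subdifferential `limsup_{y → x} ∂̂f(y)`. -/
def limitingSubdiff {d : ℕ} (f : EuclideanSpace ℝ (Fin d) → ℝ) (x : EuclideanSpace ℝ (Fin d)) :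
    Set (EuclideanSpace ℝ (Fin d)) :=
  outerLimit (frechetSubdiff f) x

end PartialLinearization

open Filter Topology MeasureTheory Metric

namespace PartialLinearization

/-! Let `ψ` denote the linearized function. A continuous gradient makes `h` strictly differentiable
at `G x`, and the Lipschitz bound on `G` then gives `f - ψ` strict derivative zero at `x`: its
Lipschitz constant on small neighbourhoods of `x` tends to zero. All three subdifferentials ignore
such a perturbation, and the roles of `f` and `ψ` are symmetric, so each equality reduces to one
inclusion.

Fréchet: the directional derivatives at `x` coincide. Clarke
(`limitingGradients_subset_clarkeSubdiff`): the two functions may be differentiable at different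
points, so gradients are compared through increments, using separation of convex sets, Rademacher
and Fubini. Limiting (`limitingSubdiff_subset`): a subgradient of one function near `x` is an
approximate subgradient of the other, and a penalized minimization (`exists_frechetSubdiff_near`)
yields an exact one nearby. -/

/-- In finite dimension, the convex hull of a compact set is compact. -/
theorem isCompact_convexHull_of_finiteDimensional {E : Type*} [NormedAddCommGroup E]
    [NormedSpace ℝ E] [FiniteDimensional ℝ E] {K : Set E} (hK : IsCompact K) :
    IsCompact (convexHull ℝ K) := by
  have key : convexHull ℝ K = ⋃ k ∈ Finset.range (Module.finrank ℝ E + 2),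
      (fun p : (Fin k → ℝ) × (Fin k → E) => ∑ i, p.1 i • p.2 i) ''
        (stdSimplex ℝ (Fin k) ×ˢ Set.univ.pi fun _ => K) := by
    apply Set.Subset.antisymm
    · intro x hx
      obtain ⟨ι, _, z, w, hz, hind, hw, hw1, hx⟩ := eq_pos_convex_span_of_mem_convexHull hx
      have hcard : Fintype.card ι ≤ Module.finrank ℝ E + 1 :=
        hind.card_le_finrank_succ.trans (by gcongr; exact Submodule.finrank_le _)
      have e := (Fintype.equivFin ι).symm
      simp only [Set.mem_iUnion, Finset.mem_range]
      refine ⟨Fintype.card ι, by omega, (w ∘ e, z ∘ e), ⟨⟨fun i => (hw _).le, ?_⟩, ?_⟩, ?_⟩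
      · rw [← hw1]; exact e.sum_comp w
      · exact fun i _ => hz ⟨_, rfl⟩
      · rw [← hx]; exact e.sum_comp fun i => w i • z i
    · simp only [Set.iUnion_subset_iff]
      rintro k - _ ⟨⟨w, z⟩, ⟨hw, hz⟩, rfl⟩
      exact (convex_convexHull ℝ K).sum_mem (fun i _ => hw.1 i) hw.2
        fun i _ => subset_convexHull ℝ K (hz i trivial)
  rw [key]
  refine (Finset.range _).isCompact_biUnion fun k _ => ?_
  exact ((isCompact_stdSimplex ℝ (Fin k)).prod (isCompact_univ_pi fun _ => hK)).image (by fun_prop)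

/-! ### Outer limits and limiting gradients -/

variable {d : ℕ}

theorem mem_outerLimit_iff {S : EuclideanSpace ℝ (Fin d) → Set (EuclideanSpace ℝ (Fin d))}
    {x s : EuclideanSpace ℝ (Fin d)} :
    s ∈ outerLimit S x ↔ (x, s) ∈ closure {p | p.2 ∈ S p.1} := by
  rw [mem_closure_iff_seq_limit]
  constructor
  · rintro ⟨u, w, hu, hw, hs⟩
    exact ⟨fun k => (u k, w k), hw, hu.prodMk_nhds hs⟩
  · rintro ⟨p, hp, hlim⟩
    rw [nhds_prod_eq, tendsto_prod_iff'] at hlim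
    exact ⟨fun k => (p k).1, fun k => (p k).2, hlim.1, hp, hlim.2⟩

/-- The set of limits of gradients whose convex hull is the Clarke subdifferential. -/
def limitingGradients (φ : EuclideanSpace ℝ (Fin d) → ℝ) (x : EuclideanSpace ℝ (Fin d)) :
    Set (EuclideanSpace ℝ (Fin d)) :=
  outerLimit (fun y => {s | HasGradientAt φ s y}) x

theorem clarkeSubdiff_eq_convexHull_limitingGradients (φ : EuclideanSpace ℝ (Fin d) → ℝ)
    (x : EuclideanSpace ℝ (Fin d)) :
    clarkeSubdiff φ x = convexHull ℝ (limitingGradients φ x) := by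
  unfold clarkeSubdiff limitingGradients outerLimit
  congr 1
  ext s
  constructor
  · rintro ⟨u, hu, hd, hs⟩
    exact ⟨u, fun k => gradient φ (u k), hu, fun k => (hd k).hasGradientAt, hs⟩
  · rintro ⟨u, w, hu, hw, hs⟩
    refine ⟨u, hu, fun k => (hw k).differentiableAt, ?_⟩
    simpa only [fun k => HasGradientAt.gradient (hw k)] using hs

theorem norm_le_of_hasGradientAt_of_lipschitzOnWith {φ : EuclideanSpace ℝ (Fin d) → ℝ}
    {U : Set (EuclideanSpace ℝ (Fin d))} {K : NNReal} (hφ : LipschitzOnWith K φ U)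
    {y s : EuclideanSpace ℝ (Fin d)} (hU : U ∈ 𝓝 y) (hs : HasGradientAt φ s y) : ‖s‖ ≤ K := by
  have h := norm_fderiv_le_of_lipschitzOn ℝ hU hφ
  rw [hs.hasFDerivAt.fderiv] at h
  simpa using h

theorem isClosed_limitingGradients (φ : EuclideanSpace ℝ (Fin d) → ℝ)
    (x : EuclideanSpace ℝ (Fin d)) : IsClosed (limitingGradients φ x) := by
  have : limitingGradients φ x =
      (fun s => (x, s)) ⁻¹' closure {p | HasGradientAt φ p.2 p.1} := by
    ext s; exact mem_outerLimit_iff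
  rw [this]
  exact isClosed_closure.preimage (by fun_prop)

theorem isCompact_limitingGradients {φ : EuclideanSpace ℝ (Fin d) → ℝ}
    {x : EuclideanSpace ℝ (Fin d)} (hφ : LipschitzNear φ x) :
    IsCompact (limitingGradients φ x) := by
  obtain ⟨U, hU, K, hK⟩ := hφ
  refine (isCompact_closedBall (0 : EuclideanSpace ℝ (Fin d)) K).of_isClosed_subset
    (isClosed_limitingGradients φ x) ?_
  rintro s ⟨u, w, hu, hw, hs⟩
  rw [mem_closedBall_zero_iff]
  refine le_of_tendsto hs.norm ?_
  filter_upwards [hu.eventually (eventually_mem_nhds_iff.2 hU)] with k hk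
  exact norm_le_of_hasGradientAt_of_lipschitzOnWith hK hk (hw k)

/-! ### Clarke subdifferential: gradient bounds and increments -/

/-- A strict bound for the limiting gradients at `x` in a direction is a bound for all gradients
near `x` in that direction. -/
theorem eventually_inner_gradient_le {φ : EuclideanSpace ℝ (Fin d) → ℝ}
    {x v : EuclideanSpace ℝ (Fin d)} {σ : ℝ} (hφ : LipschitzNear φ x)
    (hσ : ∀ s ∈ limitingGradients φ x, inner ℝ s v < σ) :
    ∀ᶠ y in 𝓝 x, ∀ s, HasGradientAt φ s y → inner ℝ s v ≤ σ := by
  obtain ⟨U, hU, K, hK⟩ := hφ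
  by_contra hcon
  have hcon := (not_eventually.1 hcon).and_eventually (eventually_mem_nhds_iff.2 hU)
  obtain ⟨u, hu, hP⟩ := exists_seq_forall_of_frequently hcon
  push Not at hP
  choose w hw hlt using fun k => (hP k).1
  have hb : ∀ k, w k ∈ closedBall (0 : EuclideanSpace ℝ (Fin d)) K := fun k =>
    mem_closedBall_zero_iff.2
      (norm_le_of_hasGradientAt_of_lipschitzOnWith hK (hP k).2 (hw k))
  obtain ⟨s, -, θ, hθ, hs⟩ := (isCompact_closedBall _ _).tendsto_subseq hb
  have hmem : s ∈ limitingGradients φ x :=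
    ⟨u ∘ θ, w ∘ θ, hu.comp hθ.tendsto_atTop, fun k => hw _, hs⟩
  refine (hσ s hmem).not_ge (ge_of_tendsto (hs.inner tendsto_const_nhds) ?_)
  exact Eventually.of_forall fun k => (hlt _).le

/-- If all gradients of a Lipschitz function on a ball are at most `σ` in the direction `v`, then
its increments in the direction `v` are at most `σ` times the step. -/
theorem sub_le_of_inner_gradient_le {φ : EuclideanSpace ℝ (Fin d) → ℝ}
    {x v : EuclideanSpace ℝ (Fin d)} {σ r : ℝ} {K : NNReal}
    (hφ : LipschitzOnWith K φ (ball x r))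
    (hσ : ∀ y ∈ ball x r, ∀ s, HasGradientAt φ s y → inner ℝ s v ≤ σ)
    {y : EuclideanSpace ℝ (Fin d)} {t : ℝ} (ht : 0 ≤ t) (hy : y ∈ ball x r)
    (hyt : y + t • v ∈ ball x r) : φ (y + t • v) - φ y ≤ σ * t := by
  -- Rademacher applies to the global extension `g`; by Fubini, almost every line parallel to `v`
  -- meets its differentiability set in almost every parameter.
  obtain ⟨g, hg, hgφ⟩ := hφ.extend_real
  have hae : ∀ᵐ y : EuclideanSpace ℝ (Fin d), ∀ᵐ τ : ℝ, y + τ • v ∈ {z | DifferentiableAt ℝ g z} :=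
    (ae_ae_add_linearMap_mem_iff (LinearMap.toSpanSingleton ℝ (EuclideanSpace ℝ (Fin d)) v)
      volume volume (measurableSet_of_differentiableAt ℝ g)).2 hg.ae_differentiableAt
  have hline : ∀ᵐ y : EuclideanSpace ℝ (Fin d),
      y ∈ ball x r → y + t • v ∈ ball x r → g (y + t • v) - g y ≤ σ * t := by
    filter_upwards [hae] with y hae hy hyt
    have hψ : LipschitzWith (K * ‖v‖₊) fun τ : ℝ => g (y + τ • v) := by
      refine hg.comp (LipschitzWith.of_dist_le_mul fun a b => ?_)
      rw [dist_add_left, dist_eq_norm, ← sub_smul, norm_smul, mul_comm, dist_eq_norm]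
      rfl
    have hac := (hψ.lipschitzOnWith (s := Set.uIcc 0 t)).absolutelyContinuousOnInterval
    have hftc := hac.integral_deriv_eq_sub
    simp only [zero_smul, add_zero] at hftc
    rw [← hftc]
    have : σ * t = ∫ _ in (0 : ℝ)..t, σ := by simp [mul_comm]
    rw [this]
    refine intervalIntegral.integral_mono_ae_restrict ht hac.intervalIntegrable_deriv
      intervalIntegrable_const ?_
    refine (ae_restrict_iff' measurableSet_Icc).2 ?_
    filter_upwards [hae] with τ hτ hτt
    have hmem : y + τ • v ∈ ball x r := by
      refine (convex_ball x r).segment_subset hy hyt ?_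
      rw [segment_eq_image']
      rcases ht.eq_or_lt with rfl | htpos
      · exact ⟨0, by simp, by simp [le_antisymm hτt.2 hτt.1]⟩
      · refine ⟨τ / t, ⟨div_nonneg hτt.1 ht, div_le_one_of_le₀ hτt.2 ht⟩, ?_⟩
        simp only [add_sub_cancel_left, smul_smul]
        rw [div_mul_cancel₀ _ htpos.ne']
    have hd : HasGradientAt g (gradient g (y + τ • v)) (y + τ • v) :=
      DifferentiableAt.hasGradientAt hτ
    have heq : φ =ᶠ[𝓝 (y + τ • v)] g := hgφ.eventuallyEq_of_mem (isOpen_ball.mem_nhds hmem)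
    have hcomp := hd.hasFDerivAt.comp_hasDerivAt τ (((hasDerivAt_id τ).smul_const v).const_add y)
    have hderiv := hcomp.deriv
    simp only [one_smul, InnerProductSpace.toDual_apply_apply] at hderiv
    exact hderiv.trans_le (hσ _ hmem _ (hd.congr_of_eventuallyEq heq))
  have hgr : g (y + t • v) - g y ≤ σ * t := by
    -- Full-measure sets are dense, so continuity carries the inequality from almost every base
    -- point to `y`.
    have hopen : ∀ᶠ z in 𝓝 y, z ∈ ball x r ∧ z + t • v ∈ ball x r :=
      (isOpen_ball.eventually_mem hy).and
        ((by fun_prop : Continuous fun z => z + t • v).continuousAt.eventually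
          (isOpen_ball.mem_nhds hyt))
    have hfreq := mem_closure_iff_frequently.1 ((Measure.dense_of_ae hline) y)
    have hc := hg.continuous
    refine le_of_tendsto_of_frequently (f := fun z => g (z + t • v) - g z) (x := 𝓝 y)
      (by fun_prop : Continuous fun z => g (z + t • v) - g z).continuousAt ?_
    exact (hfreq.and_eventually hopen).mono fun z hz => hz.1 hz.2.1 hz.2.2
  rwa [← hgφ hy, ← hgφ hyt] at hgr

theorem eventually_abs_sub_le {u : EuclideanSpace ℝ (Fin d) → ℝ}
    {x : EuclideanSpace ℝ (Fin d)}
    (hu : HasStrictFDerivAt u (0 : EuclideanSpace ℝ (Fin d) →L[ℝ] ℝ) x) {ε : ℝ} (hε : 0 < ε) :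
    ∀ᶠ p in 𝓝 (x, x), |u p.1 - u p.2| ≤ ε * ‖p.1 - p.2‖ := by
  simpa using (hasStrictFDerivAt_iff_isLittleO.1 hu).def hε

/-- A functional separating `s` from the closed hull bounds the gradients of `ψ` near `x`, hence its
increments along `v`. The increments of `φ` differ by at most `δ * ‖v‖ * t`, too little to bridge
the separation gap. -/
theorem limitingGradients_subset_clarkeSubdiff {φ ψ : EuclideanSpace ℝ (Fin d) → ℝ}
    {x : EuclideanSpace ℝ (Fin d)} (hψ : LipschitzNear ψ x)
    (hφψ : HasStrictFDerivAt (fun y => φ y - ψ y)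
      (0 : EuclideanSpace ℝ (Fin d) →L[ℝ] ℝ) x) :
    limitingGradients φ x ⊆ clarkeSubdiff ψ x := by
  intro s hs
  rw [clarkeSubdiff_eq_convexHull_limitingGradients]
  by_contra hns
  obtain ⟨l, σ, hσ, hlt⟩ := geometric_hahn_banach_closed_point (convex_convexHull ℝ _)
    (isCompact_convexHull_of_finiteDimensional (isCompact_limitingGradients hψ)).isClosed hns
  obtain ⟨v, rfl⟩ := (InnerProductSpace.toDual ℝ (EuclideanSpace ℝ (Fin d))).surjective l
  simp only [InnerProductSpace.toDual_apply_apply] at hσ hlt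
  have hgrad := eventually_inner_gradient_le (v := v) (σ := σ) hψ fun s hs => by
    rw [real_inner_comm]; exact hσ s (subset_convexHull ℝ _ hs)
  obtain ⟨δ, hδ, hδlt⟩ : ∃ δ : ℝ, 0 < δ ∧ σ + δ * ‖v‖ < inner ℝ v s := by
    refine ⟨(inner ℝ v s - σ) / (‖v‖ + 1), div_pos (by linarith) (by positivity), ?_⟩
    have : (inner ℝ v s - σ) / (‖v‖ + 1) * ‖v‖ < inner ℝ v s - σ := by
      rw [div_mul_eq_mul_div, div_lt_iff₀ (by positivity)]
      nlinarith
    linarith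
  obtain ⟨U, hU, K, hK⟩ := hψ
  have hclose := eventually_abs_sub_le hφψ hδ
  rw [nhds_prod_eq] at hclose
  obtain ⟨V, hV, hVle⟩ := mem_prod_self_iff.1 hclose
  obtain ⟨r, hr, hball⟩ := Metric.mem_nhds_iff.1 (inter_mem (inter_mem hU hV) hgrad)
  have hinc : ∀ y ∈ ball x r, ∀ t : ℝ, 0 ≤ t → y + t • v ∈ ball x r →
      φ (y + t • v) - φ y ≤ (σ + δ * ‖v‖) * t := by
    intro y hy t ht hyt
    have h1 := sub_le_of_inner_gradient_le (hK.mono fun z hz => (hball hz).1.1)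
      (fun z hz => (hball hz).2) ht hy hyt
    have h2 : |(φ (y + t • v) - ψ (y + t • v)) - (φ y - ψ y)| ≤ δ * ‖y + t • v - y‖ :=
      hVle (Set.mk_mem_prod (hball hyt).1.2 (hball hy).1.2)
    have h2 := (abs_le.1 h2).2
    rw [add_sub_cancel_left, norm_smul, Real.norm_of_nonneg ht] at h2
    linarith
  have hbound : ∀ y ∈ ball x r, ∀ w, HasGradientAt φ w y → inner ℝ w v ≤ σ + δ * ‖v‖ := by
    intro y hy w hw
    have hline := (hw.hasFDerivAt.hasLineDerivAt v).tendsto_slope_zero_right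
    simp only [InnerProductSpace.toDual_apply_apply] at hline
    refine le_of_tendsto hline ?_
    have hmem : ∀ᶠ t : ℝ in 𝓝[>] 0, y + t • v ∈ ball x r := by
      refine (ContinuousAt.eventually_mem (f := fun t : ℝ => y + t • v) (by fun_prop)
        (isOpen_ball.mem_nhds (by simpa using hy))).filter_mono nhdsWithin_le_nhds
    filter_upwards [hmem, self_mem_nhdsWithin] with t ht ht0
    have ht0 : 0 < t := ht0
    have := hinc y hy t ht0.le ht
    simp only [smul_eq_mul]
    rw [inv_mul_le_iff₀ ht0]
    linarith
  obtain ⟨u, w, hu, hw, hs⟩ := hs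
  refine hδlt.not_ge ?_
  rw [real_inner_comm]
  refine le_of_tendsto (hs.inner tendsto_const_nhds) ?_
  filter_upwards [hu.eventually (ball_mem_nhds x hr)] with k hk
  exact hbound _ hk _ (hw k)

theorem clarkeSubdiff_subset {φ ψ : EuclideanSpace ℝ (Fin d) → ℝ}
    {x : EuclideanSpace ℝ (Fin d)} (hψ : LipschitzNear ψ x)
    (hφψ : HasStrictFDerivAt (fun y => φ y - ψ y)
      (0 : EuclideanSpace ℝ (Fin d) →L[ℝ] ℝ) x) :
    clarkeSubdiff φ x ⊆ clarkeSubdiff ψ x := by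
  rw [clarkeSubdiff_eq_convexHull_limitingGradients φ]
  exact convexHull_min (limitingGradients_subset_clarkeSubdiff hψ hφψ) (convex_convexHull ℝ _)

/-! ### Directional derivatives and the Fréchet subdifferential -/

/-- Directional derivatives of two functions differ by at most `ε‖v‖` where their difference is
`ε`-calm. -/
theorem HasDirDerivAt.le_add_of_eventually_abs_sub_le {φ ψ : EuclideanSpace ℝ (Fin d) → ℝ}
    {y v : EuclideanSpace ℝ (Fin d)} {ε l m : ℝ} (hφ : HasDirDerivAt φ y v l)
    (hψ : HasDirDerivAt ψ y v m)
    (hε : ∀ᶠ z in 𝓝 y, |(φ z - ψ z) - (φ y - ψ y)| ≤ ε * ‖z - y‖) : l ≤ m + ε * ‖v‖ := by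
  have hlim := Tendsto.sub hφ hψ
  suffices l - m ≤ ε * ‖v‖ by linarith
  refine le_of_tendsto hlim ?_
  have hmem : ∀ᶠ t : ℝ in 𝓝[>] 0, |(φ (y + t • v) - ψ (y + t • v)) - (φ y - ψ y)| ≤
      ε * ‖y + t • v - y‖ := by
    have hc : Tendsto (fun t : ℝ => y + t • v) (𝓝 0) (𝓝 y) :=
      (by fun_prop : Continuous fun t : ℝ => y + t • v).tendsto' _ _ (by simp)
    exact (hc.mono_left nhdsWithin_le_nhds).eventually hε
  filter_upwards [hmem, self_mem_nhdsWithin] with t ht ht0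
  have ht0 : 0 < t := ht0
  rw [add_sub_cancel_left, norm_smul, Real.norm_of_nonneg ht0.le] at ht
  have := (abs_le.1 ht).2
  simp only [smul_eq_mul]
  rw [← mul_sub, inv_mul_le_iff₀ ht0]
  linarith

theorem frechetSubdiff_subset {φ ψ : EuclideanSpace ℝ (Fin d) → ℝ}
    {x : EuclideanSpace ℝ (Fin d)} (hψ : ∀ v, ∃ l, HasDirDerivAt ψ x v l)
    (hφψ : HasStrictFDerivAt (fun y => φ y - ψ y)
      (0 : EuclideanSpace ℝ (Fin d) →L[ℝ] ℝ) x) :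
    frechetSubdiff φ x ⊆ frechetSubdiff ψ x := by
  intro s hs v
  obtain ⟨l, hl, hsl⟩ := hs v
  obtain ⟨m, hm⟩ := hψ v
  refine ⟨m, hm, hsl.trans (le_of_forall_pos_le_add fun ε hε => ?_)⟩
  have hδ : 0 < ε / (‖v‖ + 1) := by positivity
  have hcalm := (hφψ.hasFDerivAt.isLittleO).def hδ
  simp only [zero_apply, sub_zero, Real.norm_eq_abs] at hcalm
  have := hl.le_add_of_eventually_abs_sub_le hm hcalm
  have h2 : ε / (‖v‖ + 1) * ‖v‖ ≤ ε := by
    rw [div_mul_eq_mul_div, div_le_iff₀ (by positivity)]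
    nlinarith
  linarith

/-! ### Limiting subdifferential: approximate and exact subgradients -/

/-- For a Lipschitz function, a lower bound on the directional derivatives gives a lower bound on
the function that is uniform in the direction. -/
theorem eventually_le_of_inner_le_dirDeriv {φ : EuclideanSpace ℝ (Fin d) → ℝ}
    {y s : EuclideanSpace ℝ (Fin d)} {ε : ℝ} (hε : 0 < ε) (hφ : LipschitzNear φ y)
    (hs : ∀ v, ∃ l, HasDirDerivAt φ y v l ∧ inner ℝ s v ≤ l + ε * ‖v‖) :
    ∀ᶠ z in 𝓝 y, φ y + inner ℝ s (z - y) - 2 * ε * ‖z - y‖ ≤ φ z := by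
  obtain ⟨U, hU, K, hK⟩ := hφ
  have hloc : ∀ v ∈ sphere (0 : EuclideanSpace ℝ (Fin d)) 1,
      ∀ᶠ p : ℝ × EuclideanSpace ℝ (Fin d) in 𝓝 (0, v),
        0 < p.1 → φ y + p.1 * inner ℝ s p.2 - 2 * ε * p.1 ≤ φ (y + p.1 • p.2) := by
    intro v hv
    obtain ⟨l, hl, hsl⟩ := hs v
    rw [mem_sphere_zero_iff_norm.1 hv, mul_one] at hsl
    have h1 : ∀ᶠ t : ℝ in 𝓝 0, 0 < t → l - ε / 2 < t⁻¹ • (φ (y + t • v) - φ y) :=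
      eventually_nhdsWithin_iff.1 (hl.eventually (lt_mem_nhds (by linarith)))
    have h2 : ∀ᶠ p : ℝ × EuclideanSpace ℝ (Fin d) in 𝓝 (0, v), y + p.1 • p.2 ∈ U :=
      ((by fun_prop : Continuous fun p : ℝ × EuclideanSpace ℝ (Fin d) => y + p.1 • p.2).tendsto'
        (0, v) y (by simp)).eventually hU
    have h3 : ∀ᶠ t : ℝ in 𝓝 0, y + t • v ∈ U :=
      ((by fun_prop : Continuous fun t : ℝ => y + t • v).tendsto' 0 y (by simp)).eventually hU
    -- The extra `ε` is split in two: half for the difference quotient along `v`, half for replacing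
    -- `v` by a nearby `w`.
    have h4 : ∀ᶠ w in 𝓝 v, K * ‖w - v‖ + inner ℝ s (w - v) < ε / 2 :=
      ((by fun_prop : Continuous fun w => K * ‖w - v‖ + inner ℝ s (w - v)).tendsto' v 0
        (by simp)).eventually (gt_mem_nhds (by linarith))
    rw [nhds_prod_eq] at h2 ⊢
    filter_upwards [h2, (h1.and h3).prod_inl (𝓝 v), h4.prod_inr (𝓝 0)] with p h2 h13 h4 hp
    obtain ⟨t, w⟩ := p
    obtain ⟨h1, h3⟩ := h13
    simp only at *
    have h1 := h1 hp
    rw [smul_eq_mul, lt_inv_mul_iff₀ hp] at h1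
    have hL := (abs_le.1 (hK.norm_sub_le h2 h3)).1
    rw [add_sub_add_left_eq_sub, ← smul_sub, norm_smul, Real.norm_of_nonneg hp.le] at hL
    rw [inner_sub_right] at h4
    nlinarith
  have hall := (isCompact_sphere (0 : EuclideanSpace ℝ (Fin d))
    1).eventually_forall_of_forall_eventually
    (P := fun (t : ℝ) w => 0 < t → φ y + t * inner ℝ s w - 2 * ε * t ≤ φ (y + t • w)) hloc
  have hnorm : Tendsto (fun z => ‖z - y‖) (𝓝 y) (𝓝 0) :=
    (by fun_prop : Continuous fun z => ‖z - y‖).tendsto' _ _ (by simp)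
  filter_upwards [hnorm.eventually hall] with z hz
  rcases eq_or_ne z y with rfl | hne
  · simp
  have hpos : 0 < ‖z - y‖ := norm_pos_iff.2 (sub_ne_zero.2 hne)
  have := hz (‖z - y‖⁻¹ • (z - y)) (by simp [norm_smul, hpos.ne']) hpos
  rwa [smul_inv_smul₀ hpos.ne', inner_smul_right, mul_inv_cancel_left₀ hpos.ne',
    add_sub_cancel] at this

/-- An approximate subgradient at `y` is close to a Fréchet subgradient at a nearby point. -/
theorem exists_frechetSubdiff_near {φ : EuclideanSpace ℝ (Fin d) → ℝ}
    {y s : EuclideanSpace ℝ (Fin d)} {ε r : ℝ} (hε : 0 < ε) (hr : 0 < r)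
    (hc : ContinuousOn φ (closedBall y r))
    (hdir : ∀ z ∈ ball y r, ∀ v, ∃ l, HasDirDerivAt φ z v l)
    (hmin : ∀ z ∈ closedBall y r, φ y + inner ℝ s (z - y) - ε * ‖z - y‖ ≤ φ z) :
    ∃ z ∈ ball y r, ∃ t ∈ frechetSubdiff φ z, ‖t - s‖ ≤ 2 * ε := by
  -- With this weight, `c * ‖z - y‖ ≤ ε` puts the minimizer within `r / 2` of `y`, hence inside the
  -- open ball, and bounds the penalty gradient `(2 * c) • (z - y)` by `2 * ε`.
  set c : ℝ := 2 * ε / r with hcdef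
  have hc0 : 0 < c := by positivity
  obtain ⟨z, hz, hzmin⟩ := (isCompact_closedBall y r).exists_isMinOn
    (f := fun z => φ z - inner ℝ s (z - y) + c * ‖z - y‖ ^ 2)
    ⟨y, mem_closedBall_self hr.le⟩ (by fun_prop)
  have hzr : c * ‖z - y‖ ≤ ε := by
    have h1 := hzmin (mem_closedBall_self hr.le)
    have h2 := hmin z hz
    simp only [Set.mem_ofPred_eq, sub_self, inner_zero_right, norm_zero] at h1
    by_contra! hlt
    have : 0 < ‖z - y‖ := by
      by_contra! h0
      nlinarith
    nlinarith
  have hzball : z ∈ ball y r := by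
    rw [mem_ball, dist_eq_norm]
    rw [hcdef, div_mul_eq_mul_div, div_le_iff₀ hr] at hzr
    nlinarith
  refine ⟨z, hzball, s - (2 * c) • (z - y), fun v => ?_, ?_⟩
  · obtain ⟨l, hl⟩ := hdir z hzball v
    refine ⟨l, hl, ?_⟩
    have hlim : Tendsto (fun t : ℝ => inner ℝ (s - (2 * c) • (z - y)) v - c * t * ‖v‖ ^ 2) (𝓝[>] 0)
        (𝓝 (inner ℝ (s - (2 * c) • (z - y)) v)) :=
      ((by fun_prop : Continuous fun t : ℝ =>
        inner ℝ (s - (2 * c) • (z - y)) v - c * t * ‖v‖ ^ 2).tendsto' 0 _ (by simp)).mono_left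
        nhdsWithin_le_nhds
    refine le_of_tendsto_of_tendsto hlim hl ?_
    have hmem : ∀ᶠ t : ℝ in 𝓝[>] 0, z + t • v ∈ ball y r :=
      (ContinuousAt.eventually_mem (f := fun t : ℝ => z + t • v) (by fun_prop)
        (isOpen_ball.mem_nhds (by simpa using hzball))).filter_mono nhdsWithin_le_nhds
    filter_upwards [hmem, self_mem_nhdsWithin] with t ht ht0
    have ht0 : 0 < t := ht0
    have h1 := hzmin (ball_subset_closedBall ht)
    simp only [Set.mem_ofPred_eq] at h1
    have h2 : z + t • v - y = (z - y) + t • v := by abel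
    rw [h2, norm_add_sq_real, inner_add_right, inner_smul_right, inner_smul_right, norm_smul,
      Real.norm_of_nonneg ht0.le] at h1
    rw [smul_eq_mul, le_inv_mul_iff₀ ht0, inner_sub_left, real_inner_smul_left]
    linarith
  · rw [sub_sub_cancel_left, norm_neg, norm_smul, Real.norm_of_nonneg (by positivity)]
    linarith

theorem limitingSubdiff_subset {φ ψ : EuclideanSpace ℝ (Fin d) → ℝ}
    {x : EuclideanSpace ℝ (Fin d)} (hψ : LipschitzNear ψ x)
    (hdir : ∀ᶠ y in 𝓝 x, ∀ v, ∃ l, HasDirDerivAt ψ y v l)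
    (hφψ : HasStrictFDerivAt (fun y => φ y - ψ y)
      (0 : EuclideanSpace ℝ (Fin d) →L[ℝ] ℝ) x) :
    limitingSubdiff φ x ⊆ limitingSubdiff ψ x := by
  intro s hs
  obtain ⟨U, hU, K, hK⟩ := hψ
  refine mem_outerLimit_iff.2 (Metric.mem_closure_iff.2 fun ε hε => ?_)
  obtain ⟨u, w, hu, hw, hs⟩ := hs
  -- Passing to a uniform lower bound doubles `ε / 8`, and the penalized minimization doubles it
  -- again: the total `ε / 2` leaves `ε / 2` for the distance from `w k` to `s`.
  have hδ : 0 < ε / 8 := by positivity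
  have hclose := ((hu.prodMk_nhds hu).eventually
    (eventually_abs_sub_le hφψ hδ).eventually_nhds)
  obtain ⟨k, ⟨hkU, hkdir, hkx⟩, hkclose, hks⟩ := ((hu.eventually
    ((eventually_mem_nhds_iff.2 hU).and (hdir.eventually_nhds.and
      (ball_mem_nhds x hε)))).and (hclose.and (hs.eventually (ball_mem_nhds s (half_pos hε))))).exists
  have hcalm : ∀ᶠ z in 𝓝 (u k), |(φ z - ψ z) - (φ (u k) - ψ (u k))| ≤ ε / 8 * ‖z - u k‖ :=
    ((by fun_prop : Continuous fun z => (z, u k)).tendsto (u k)).eventually hkclose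
  have hlower := eventually_le_of_inner_le_dirDeriv hδ ⟨U, hkU, K, hK⟩ fun v => by
    obtain ⟨l, hl, hsl⟩ := hw k v
    obtain ⟨m, hm⟩ := hkdir.self_of_nhds v
    exact ⟨m, hm, hsl.trans (hl.le_add_of_eventually_abs_sub_le hm hcalm)⟩
  obtain ⟨r, hr, hball⟩ := Metric.nhds_basis_closedBall.mem_iff.1
    (inter_mem (inter_mem hkU hkdir) (inter_mem hlower (isOpen_ball.mem_nhds hkx)))
  obtain ⟨z, hz, t, ht, hts⟩ := exists_frechetSubdiff_near (ε := 2 * (ε / 8)) (by positivity) hr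
    (hK.continuousOn.mono fun z hz => (hball hz).1.1)
    (fun z hz => (hball (ball_subset_closedBall hz)).1.2) fun z hz => (hball hz).2.1
  refine ⟨(z, t), ht, ?_⟩
  rw [dist_comm, Prod.dist_eq, max_lt_iff]
  refine ⟨(hball (ball_subset_closedBall hz)).2.2, ?_⟩
  have h1 : dist (w k) s < ε / 2 := hks
  have h2 := dist_triangle t (w k) s
  rw [dist_eq_norm t (w k)] at h2
  simp only
  linarith

/-! ### The composition and its partial linearization -/

theorem hasStrictFDerivAt_of_lipschitzGradientNear {n : ℕ} {h : EuclideanSpace ℝ (Fin n) → ℝ}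
    {z : EuclideanSpace ℝ (Fin n)} (hh : LipschitzGradientNear h z) :
    HasStrictFDerivAt h (InnerProductSpace.toDual ℝ _ (gradient h z)) z := by
  obtain ⟨hd, U, hU, K, hK⟩ := hh
  refine hasStrictFDerivAt_of_hasFDerivAt_of_continuousAt
    (f' := fun y => InnerProductSpace.toDual ℝ _ (gradient h y))
    (hd.mono fun y hy => hy.hasGradientAt.hasFDerivAt) ?_
  exact (InnerProductSpace.toDual ℝ _).continuous.continuousAt.comp
    (hK.continuousOn.continuousAt hU)

theorem LipschitzNear.continuousAt {n : ℕ} {G : EuclideanSpace ℝ (Fin d) → EuclideanSpace ℝ (Fin n)}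
    {x : EuclideanSpace ℝ (Fin d)} (hG : LipschitzNear G x) : ContinuousAt G x := by
  obtain ⟨U, hU, K, hK⟩ := hG
  exact hK.continuousOn.continuousAt hU

/-- Partial linearization of the outer function changes a composition only by a function whose
strict derivative vanishes. -/
theorem hasStrictFDerivAt_comp_sub_inner_comp {n : ℕ} {h : EuclideanSpace ℝ (Fin n) → ℝ}
    {G : EuclideanSpace ℝ (Fin d) → EuclideanSpace ℝ (Fin n)} {x : EuclideanSpace ℝ (Fin d)}
    {c : EuclideanSpace ℝ (Fin n)}
    (hh : HasStrictFDerivAt h (InnerProductSpace.toDual ℝ _ c) (G x)) (hG : LipschitzNear G x) :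
    HasStrictFDerivAt (fun y => (h ∘ G) y - inner ℝ c (G y))
      (0 : EuclideanSpace ℝ (Fin d) →L[ℝ] ℝ) x := by
  have hGc : ContinuousAt G x := hG.continuousAt
  obtain ⟨U, hU, K, hK⟩ := hG
  rw [hasStrictFDerivAt_iff_isLittleO] at hh ⊢
  have hlim : Tendsto (fun p : EuclideanSpace ℝ (Fin d) × EuclideanSpace ℝ (Fin d) =>
      (G p.1, G p.2)) (𝓝 (x, x)) (𝓝 (G x, G x)) :=
    (hGc.tendsto.comp (continuous_fst.tendsto (x, x))).prodMk_nhds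
      (hGc.tendsto.comp (continuous_snd.tendsto (x, x)))
  have hO : (fun p : EuclideanSpace ℝ (Fin d) × EuclideanSpace ℝ (Fin d) => G p.1 - G p.2)
      =O[𝓝 (x, x)] fun p => p.1 - p.2 := by
    refine Asymptotics.IsBigO.of_bound K ?_
    filter_upwards [prod_mem_nhds hU hU] with p hp
    exact hK.norm_sub_le hp.1 hp.2
  refine ((hh.comp_tendsto hlim).trans_isBigO hO).congr_left fun p => ?_
  simp only [Function.comp_apply, InnerProductSpace.toDual_apply_apply, inner_sub_right,
    zero_apply]
  ring

theorem HasDirDerivAt.inner_const {n : ℕ} {G : EuclideanSpace ℝ (Fin d) → EuclideanSpace ℝ (Fin n)}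
    {y v : EuclideanSpace ℝ (Fin d)} {l : EuclideanSpace ℝ (Fin n)} (hG : HasDirDerivAt G y v l)
    (c : EuclideanSpace ℝ (Fin n)) :
    HasDirDerivAt (fun z => inner ℝ c (G z)) y v (inner ℝ c l) := by
  refine (Tendsto.inner (tendsto_const_nhds (x := c)) hG).congr fun t => ?_
  rw [real_inner_smul_right, inner_sub_right, smul_eq_mul]

/-- Chain rule for one-sided directional derivatives with differentiable outer function. -/
theorem HasDirDerivAt.differentiableAt_comp {n : ℕ} {h : EuclideanSpace ℝ (Fin n) → ℝ}
    {G : EuclideanSpace ℝ (Fin d) → EuclideanSpace ℝ (Fin n)}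
    {y v : EuclideanSpace ℝ (Fin d)} {l : EuclideanSpace ℝ (Fin n)} (hG : HasDirDerivAt G y v l)
    (hh : DifferentiableAt ℝ h (G y)) :
    HasDirDerivAt (h ∘ G) y v (fderiv ℝ h (G y) l) := by
  have hcurve : HasDerivWithinAt (fun t : ℝ => G (y + t • v)) l (Set.Ioi 0) 0 := by
    rw [hasDerivWithinAt_iff_tendsto_slope' (by simp)]
    refine hG.congr fun t => ?_
    simp [slope_def_module]
  have hcomp := HasFDerivAt.comp_hasDerivWithinAt (x := (0 : ℝ)) (l := h)
    (l' := fderiv ℝ h (G y)) (by simpa using hh.hasFDerivAt) hcurve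
  rw [hasDerivWithinAt_iff_tendsto_slope' (by simp)] at hcomp
  refine Tendsto.congr (fun t => ?_) hcomp
  simp [slope_def_module]

theorem LipschitzNear.inner_const {n : ℕ}
    {G : EuclideanSpace ℝ (Fin d) → EuclideanSpace ℝ (Fin n)} {x : EuclideanSpace ℝ (Fin d)}
    (hG : LipschitzNear G x) (c : EuclideanSpace ℝ (Fin n)) :
    LipschitzNear (fun y => inner ℝ c (G y)) x := by
  obtain ⟨U, hU, K, hK⟩ := hG
  exact ⟨U, hU, _, (InnerProductSpace.toDual ℝ _ c).lipschitz.comp_lipschitzOnWith hK⟩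

end PartialLinearization

theorem mainTheorem11 {d n : ℕ} (x : EuclideanSpace ℝ (Fin d))
    (f : EuclideanSpace ℝ (Fin d) → ℝ)
    (h : EuclideanSpace ℝ (Fin n) → ℝ)
    (G : EuclideanSpace ℝ (Fin d) → EuclideanSpace ℝ (Fin n))
    (hf : LocallyLipschitz f) (hfG : f = h ∘ G)
    (hh : PartialLinearization.LipschitzGradientNear h (G x))
    (hG : PartialLinearization.LipschitzNear G x)
    (hhdir : PartialLinearization.DirDifferentiable h)
    (hGdir : PartialLinearization.DirDifferentiable G) :
    PartialLinearization.clarkeSubdiff f x =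
        PartialLinearization.clarkeSubdiff (fun y => inner ℝ (gradient h (G x)) (G y)) x ∧
      PartialLinearization.limitingSubdiff f x =
        PartialLinearization.limitingSubdiff (fun y => inner ℝ (gradient h (G x)) (G y)) x ∧
      PartialLinearization.frechetSubdiff f x =
        PartialLinearization.frechetSubdiff (fun y => inner ℝ (gradient h (G x)) (G y)) x := by
  have hstrict := PartialLinearization.hasStrictFDerivAt_comp_sub_inner_comp
    (PartialLinearization.hasStrictFDerivAt_of_lipschitzGradientNear hh) hG
  rw [← hfG] at hstrict
  have hstrict' : HasStrictFDerivAt (fun y => inner ℝ (gradient h (G x)) (G y) - f y)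
      (0 : EuclideanSpace ℝ (Fin d) →L[ℝ] ℝ) x := by
    simpa using hstrict.fun_neg
  have hfnear : PartialLinearization.LipschitzNear f x := by
    obtain ⟨K, U, hU, hK⟩ := hf x
    exact ⟨U, hU, K, hK⟩
  have hbnear := hG.inner_const (gradient h (G x))
  have hfdir : ∀ᶠ y in 𝓝 x, ∀ v, ∃ l, PartialLinearization.HasDirDerivAt f y v l := by
    filter_upwards [hG.continuousAt.eventually hh.1] with y hy v
    obtain ⟨l, hl⟩ := hGdir y v
    exact ⟨_, hfG ▸ hl.differentiableAt_comp hy⟩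
  have hbdir : ∀ y v, ∃ l, PartialLinearization.HasDirDerivAt
      (fun y => inner ℝ (gradient h (G x)) (G y)) y v l := fun y v => by
    obtain ⟨l, hl⟩ := hGdir y v
    exact ⟨_, hl.inner_const _⟩
  refine ⟨?_, ?_, ?_⟩
  · exact (PartialLinearization.clarkeSubdiff_subset hbnear hstrict).antisymm
      (PartialLinearization.clarkeSubdiff_subset hfnear hstrict')
  · exact (PartialLinearization.limitingSubdiff_subset hbnear (Eventually.of_forall hbdir)
      hstrict).antisymm (PartialLinearization.limitingSubdiff_subset hfnear hfdir hstrict')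
  · exact (PartialLinearization.frechetSubdiff_subset (hbdir x) hstrict).antisymm
      (PartialLinearization.frechetSubdiff_subset hfdir.self_of_nhds hstrict')
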